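/- Let $I=(0,1)$. For real $\alpha,\beta>-1$ put $\chi^{\alpha,\beta}(t)=(-\log t)^\alpha t^\beta$, let $L^2_{\chi^{\alpha,\beta}}(I)$ be the real weighted $L^2$ space with norm $\|v\|_{\chi^{\alpha,\beta}}=\big(\int_0^1 v^2\,\chi^{\alpha,\beta}\,dt\big)^{1/2}$, and let $\widehat\partial_t u=t\,\partial_t u$, where $\partial_t$ is the weak derivative on $I$. For an integer $m\ge 0$ let $$A^m_{\alpha,\beta}(I)=\{v\in L^2_{\chi^{\alpha,\beta}}(I):\ \widehat\partial_t^{\,j}v\in L^2_{\chi^{\alpha+j,\beta}}(I),\ j=1,\dots,m\}.$$ For an integer $N\ge 0$ and $u\in L^2_{\chi^{\alpha,\beta}}(I)$ there is exactly one $\pi_N^{\alpha,\beta}u\in\mathcal P_N^{\log t}:=\mathrm{span}\{1,\log t,\dots,(\log t)^N\}$ with $\int_0^1 (u-\pi_N^{\alpha,\beta}u)\,v\,\chi^{\alpha,\beta}\,dt=0$ for all $v\in\mathcal P_N^{\log t}$ (the orthogonal projection). Theorem. Let $m,N,k\ge 0$ be integers, $\alpha,\beta>-1$, $u\in A^m_{\alpha,\beta}(I)$,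 $\widetilde m=\min\{m,N+1\}$ and $0\le k\le\widetilde m$. Then $u-\pi_N^{\alpha,\beta}u\in A^m_{\alpha,\beta}(I)$ and $$\big\|\widehat\partial_t^{\,k}(u-\pi_N^{\alpha,\beta}u)\big\|_{\chi^{\alpha+k,\beta}}\le\sqrt{(\beta+1)^{k-\widetilde m}\,\frac{(N-\widetilde m+1)!}{(N-k+1)!}}\ \big\|\widehat\partial_t^{\,\widetilde m}u\big\|_{\chi^{\alpha+\widetilde m,\beta}}.$$ In particular, for every integer $m\ge 0$ there is a constant $c>0$ depending only on $m$ such that for all integers $N\ge 0$ with $m<N+1$ and all $u\in A^m_{0,0}(I)$, $$\|u-\pi_N^{0,0}u\|_{L^2(I)}\le c\,N^{-m/2}\,\big\|\widehat\partial_t^{\,m}u\big\|_{\chi^{m,0}},\qquad \chi^{m,0}(t)=(-\log t)^m$$ (with $0^0=1$ when $N=m=0$). -/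

import Mathlib

open scoped ContDiff Nat

noncomputable section

namespace LOF

/-- The weight `χ^{α,β}(t) = (-log t)^α t^β`, used on `(0,1)`. -/
def chi (α β t : ℝ) : ℝ := (-Real.log t) ^ α * t ^ β

/-- The measure `χ^{α,β}(t) dt` on the interval `(0,1)`. -/
def chiMeasure (α β : ℝ) : MeasureTheory.Measure ℝ :=
  (MeasureTheory.volume.restrict (Set.Ioo (0 : ℝ) 1)).withDensity
    (fun t => ENNReal.ofReal (chi α β t))

/-- Membership in the weighted space `L²_{χ^{α,β}}(0,1)`. -/
def MemL2 (α β : ℝ) (v : ℝ → ℝ) : Prop := MeasureTheory.MemLp v 2 (chiMeasure α β)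

/-- The norm of `L²_{χ^{α,β}}(0,1)`. -/
def norm2 (α β : ℝ) (v : ℝ → ℝ) : ℝ := (MeasureTheory.eLpNorm v 2 (chiMeasure α β)).toReal

/-- The inner product of `L²_{χ^{α,β}}(0,1)`. -/
def inner2 (α β : ℝ) (v w : ℝ → ℝ) : ℝ := ∫ t, v t * w t ∂(chiMeasure α β)

/-- `w` is a weak (distributional) derivative of `u` on the interval `(0,1)`. -/
def IsWeakDeriv (u w : ℝ → ℝ) : Prop :=
  MeasureTheory.LocallyIntegrableOn u (Set.Ioo 0 1) ∧
  MeasureTheory.LocallyIntegrableOn w (Set.Ioo 0 1) ∧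
  ∀ ψ : ℝ → ℝ, ContDiff ℝ ∞ ψ → HasCompactSupport ψ → tsupport ψ ⊆ Set.Ioo 0 1 →
    ∫ t in Set.Ioo (0 : ℝ) 1, u t * deriv ψ t = -∫ t in Set.Ioo (0 : ℝ) 1, w t * ψ t

/-- `u` has a weak derivative on `(0,1)` that is a locally integrable function. -/
def HasWeakDeriv (u : ℝ → ℝ) : Prop := ∃ w, IsWeakDeriv u w

open Classical in
/-- The weak derivative of `u` on `(0,1)`, which is unique up to a null set of `(0,1)`;
the value `0` is a default, used only when `u` has no weak derivative. -/
def weakDeriv (u : ℝ → ℝ) : ℝ → ℝ :=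
  if h : HasWeakDeriv u then Classical.choose h else 0

/-- The pseudo-derivative `t ∂ₜ u`. -/
def pseudoDeriv (u : ℝ → ℝ) : ℝ → ℝ := fun t => t * weakDeriv u t

/-- The space `A^m_{α,β}(0,1)`: all `v ∈ L²_{χ^{α,β}}` such that `(t ∂ₜ)^j v` exists and lies in
`L²_{χ^{α+j,β}}` for `j = 1, …, m`. -/
def spaceA (m : ℕ) (α β : ℝ) : Set (ℝ → ℝ) :=
  {v | MemL2 α β v ∧ ∀ j : ℕ, j < m →
    HasWeakDeriv (pseudoDeriv^[j] v) ∧ MemL2 (α + ((j + 1 : ℕ) : ℝ)) β (pseudoDeriv^[j + 1] v)}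

/-- The space spanned by `1, log t, …, (log t)^N`. -/
def logPoly (N : ℕ) : Submodule ℝ (ℝ → ℝ) :=
  Submodule.span ℝ (Set.range fun n : Fin (N + 1) => fun t : ℝ => Real.log t ^ (n : ℕ))

/-- `p` is the orthogonal projection of `u` onto the span of `1, log t, …, (log t)^N`
in `L²_{χ^{α,β}}(0,1)`. -/
def IsLogProjection (α β : ℝ) (N : ℕ) (u p : ℝ → ℝ) : Prop :=
  p ∈ logPoly N ∧ ∀ v ∈ logPoly N, inner2 α β (u - p) v = 0

end LOF

end

namespace LOF

open MeasureTheory Set Filter Topology Polynomial ProbabilityTheory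

/-! Under x = -log t the measure χ^{α,β} dt becomes x^α e^{-(β+1)x} dx, polynomials in log t become
polynomials in x, and D = t ∂ₜ becomes -d/dx: this is Laguerre approximation on the half-line.

Integration by parts gives D, from weight α to weight α+1, an adjoint D* on polynomials in log t
(`adjPoly`, `inner2_mul_logEval`). The symmetric operator D*D preserves degree and multiplies a
leading coefficient of degree n by n(β+1), so these numbers are its eigenvalues. Hence v orthogonal
to all degrees < N satisfies N(β+1)‖v‖² ≤ ‖Dv‖² (`spectralGap`). For polynomials this is an
induction on the degree, without explicit Laguerre polynomials; it passes to the whole space because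
polynomials in log t are dense (`ae_eq_zero_of_inner2_logEval`), a consequence of moment
determinacy.

As D* raises degrees by at most one, v orthogonal to degrees < n has D^j v orthogonal to degrees < n
- j. With n = N+1, chaining the gaps (n-j)(β+1) over k ≤ j < m̃ produces the constant
(`inner2_iterate_le`). Finally D^m̃(u - πu) is orthogonal to D^m̃ πu, so Pythagoras replaces it by
D^m̃ u (`inner2_iterate_sub_le`). -/

/-! ### The weight and its measure. -/

lemma chi_pos (α β : ℝ) {t : ℝ} (ht : t ∈ Ioo (0 : ℝ) 1) : 0 < chi α β t :=
  mul_pos (Real.rpow_pos_of_pos (neg_pos.2 (Real.log_neg ht.1 ht.2)) _) (Real.rpow_pos_of_pos ht.1 _)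

lemma measurable_chi (α β : ℝ) : Measurable (chi α β) := by
  unfold chi; fun_prop

lemma chi_add_one (α β : ℝ) {t : ℝ} (ht : t ∈ Ioo (0 : ℝ) 1) :
    chi (α + 1) β t = (-Real.log t) * chi α β t := by
  have : 0 < -Real.log t := neg_pos.2 (Real.log_neg ht.1 ht.2)
  rw [chi, chi, Real.rpow_add_one this.ne']; ring

lemma chi_mul_pow (α β : ℝ) (n : ℕ) {t : ℝ} (ht : t ∈ Ioo (0 : ℝ) 1) :
    (-Real.log t) ^ n * chi α β t = chi (α + n) β t := by
  have : 0 < -Real.log t := neg_pos.2 (Real.log_neg ht.1 ht.2)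
  rw [chi, chi, Real.rpow_add_natCast this.ne']; ring

lemma chi_mul_rpow (α β s : ℝ) {t : ℝ} (ht : t ∈ Ioo (0 : ℝ) 1) :
    t ^ s * chi α β t = chi α (β + s) t := by
  rw [chi, chi, Real.rpow_add ht.1]; ring

lemma image_exp_neg : (fun x : ℝ => Real.exp (-x)) '' Ioi 0 = Ioo (0 : ℝ) 1 := by
  ext t
  constructor
  · rintro ⟨x, hx, rfl⟩
    exact ⟨Real.exp_pos _, by simpa using hx⟩
  · intro ht
    refine ⟨-Real.log t, ?_, ?_⟩
    · simpa using Real.log_neg ht.1 ht.2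
    · simp [Real.exp_log ht.1]

/-- The substitution t = e^{-x} turns this into a Gamma integral with rate β + 1. -/
lemma integrableOn_chi {α β : ℝ} (hα : -1 < α) (hβ : -1 < β) :
    IntegrableOn (chi α β) (Ioo 0 1) := by
  have hinj : InjOn (fun x : ℝ => Real.exp (-x)) (Ioi 0) := fun x _ y _ h => by
    simpa using h
  have hd : ∀ x ∈ Ioi (0 : ℝ), HasDerivWithinAt (fun x : ℝ => Real.exp (-x))
      (-Real.exp (-x)) (Ioi 0) x := fun x _ => by
    simpa using ((hasDerivAt_id x).neg.exp).hasDerivWithinAt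
  rw [← image_exp_neg, integrableOn_image_iff_integrableOn_abs_deriv_smul measurableSet_Ioi hd hinj]
  refine (integrableOn_rpow_mul_exp_neg_mul_rpow hα one_pos
    (show 0 < β + 1 by linarith)).congr_fun (fun x hx => ?_) measurableSet_Ioi
  simp only [chi, abs_neg, Real.abs_exp, Real.log_exp, neg_neg, Real.rpow_one, smul_eq_mul,
    ← Real.exp_mul]
  rw [mul_left_comm, ← Real.exp_add]
  ring_nf

lemma ae_chiMeasure {α β : ℝ} {p : ℝ → Prop} :
    (∀ᵐ t ∂chiMeasure α β, p t) ↔ ∀ᵐ t ∂(volume.restrict (Ioo (0 : ℝ) 1)), p t := by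
  rw [chiMeasure, ae_withDensity_iff (measurable_chi α β).ennreal_ofReal]
  refine eventually_congr ?_
  filter_upwards [ae_restrict_mem measurableSet_Ioo] with t ht
  simp [chi_pos α β ht]

lemma ae_mem_chiMeasure (α β : ℝ) : ∀ᵐ t ∂chiMeasure α β, t ∈ Ioo (0 : ℝ) 1 :=
  ae_chiMeasure.2 (ae_restrict_mem measurableSet_Ioo)

lemma integral_chiMeasure (α β : ℝ) (f : ℝ → ℝ) :
    ∫ t, f t ∂chiMeasure α β = ∫ t in Ioo (0 : ℝ) 1, chi α β t * f t := by
  rw [chiMeasure, integral_withDensity_eq_integral_toReal_smul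
    (measurable_chi α β).ennreal_ofReal (by simp)]
  refine setIntegral_congr_fun measurableSet_Ioo fun t ht => ?_
  simp [ENNReal.toReal_ofReal (chi_pos α β ht).le]

lemma integrable_chiMeasure {α β : ℝ} {f : ℝ → ℝ} :
    Integrable f (chiMeasure α β) ↔ IntegrableOn (fun t => chi α β t * f t) (Ioo 0 1) := by
  rw [chiMeasure, integrable_withDensity_iff_integrable_smul'
    (measurable_chi α β).ennreal_ofReal (by simp)]
  refine integrableOn_congr_fun (fun t ht => ?_) measurableSet_Ioo
  simp [ENNReal.toReal_ofReal (chi_pos α β ht).le]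

lemma isFiniteMeasure_chiMeasure {α β : ℝ} (hα : -1 < α) (hβ : -1 < β) :
    IsFiniteMeasure (chiMeasure α β) := by
  have : Integrable (fun _ : ℝ => (1 : ℝ)) (chiMeasure α β) := by
    rw [integrable_chiMeasure]; simpa using integrableOn_chi hα hβ
  exact (integrable_const_iff_isFiniteMeasure one_ne_zero).1 this

/-! ### Polynomials in log t. -/

/-- The function `t ↦ P (log t)`, as a linear function of the polynomial `P`. -/
noncomputable def logEval : ℝ[X] →ₗ[ℝ] (ℝ → ℝ) where
  toFun P := fun t => P.eval (Real.log t)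
  map_add' P Q := by ext; simp
  map_smul' c P := by ext; simp

lemma logEval_apply (P : ℝ[X]) (t : ℝ) : logEval P t = P.eval (Real.log t) := rfl

lemma measurable_logEval (P : ℝ[X]) : Measurable (logEval P) := by
  change Measurable fun t => P.eval (Real.log t)
  exact P.continuous.measurable.comp Real.measurable_log

lemma memL2_rpow {α β s : ℝ} (hα : -1 < α) (hβ : -1 < β + s * 2) :
    MemL2 α β (fun t => t ^ s) := by
  refine (memLp_two_iff_integrable_sq (by fun_prop)).2 ?_
  rw [integrable_chiMeasure]
  refine (integrableOn_chi hα hβ).congr_fun (fun t ht => ?_) measurableSet_Ioo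
  have : (t ^ s) ^ 2 = t ^ (s * 2) := by
    rw [Real.rpow_mul ht.1.le]; norm_cast
  change _ = chi α β t * (t ^ s) ^ 2
  rw [this, mul_comm (chi α β t), chi_mul_rpow _ _ _ ht]

lemma memL2_logEval {α β : ℝ} (hα : -1 < α) (hβ : -1 < β) (P : ℝ[X]) :
    MemL2 α β (logEval P) := by
  induction P using Polynomial.induction_on' with
  | add p q hp hq => rw [map_add]; exact hp.add hq
  | monomial n a =>
    have h : MemL2 α β (fun t => Real.log t ^ n) := by
      refine (memLp_two_iff_integrable_sq (by fun_prop)).2 ?_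
      rw [integrable_chiMeasure]
      have : -1 < α + ((2 * n : ℕ) : ℝ) := by
        have : (0 : ℝ) ≤ ((2 * n : ℕ) : ℝ) := Nat.cast_nonneg _
        linarith
      refine (integrableOn_chi this hβ).congr_fun (fun t ht => ?_) measurableSet_Ioo
      rw [← chi_mul_pow _ _ _ ht, pow_mul', ← neg_pow_two]
      ring_nf
      simp
    have h2 : logEval (monomial n a) = fun t => a * Real.log t ^ n := by
      ext t; simp [logEval_apply]
    rw [h2]
    exact h.const_mul a

lemma MemL2.integrable_mul {α β : ℝ} {f g : ℝ → ℝ} (hf : MemL2 α β f) (hg : MemL2 α β g) :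
    Integrable (fun t => f t * g t) (chiMeasure α β) :=
  MemLp.integrable_mul hf hg

lemma mem_logPoly {N : ℕ} {p : ℝ → ℝ} :
    p ∈ logPoly N ↔ ∃ P ∈ degreeLT ℝ (N + 1), logEval P = p := by
  have : logPoly N = (degreeLT ℝ (N + 1)).map logEval := by
    rw [logPoly, degreeLT_eq_span_X_pow, Submodule.map_span]
    congr 1
    ext f
    constructor
    · rintro ⟨n, rfl⟩
      exact ⟨X ^ (n : ℕ), by simpa using ⟨(n : ℕ), Nat.lt_succ_iff.1 n.2, rfl⟩,
        by ext t; simp [logEval_apply]⟩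
    · rintro ⟨P, hP, rfl⟩
      simp only [Finset.coe_image, Finset.coe_range, mem_image, mem_Iio] at hP
      obtain ⟨n, hn, rfl⟩ := hP
      exact ⟨⟨n, hn⟩, by ext t; simp [logEval_apply]⟩
  rw [this, Submodule.mem_map]

/-- A nonzero P has finitely many roots, so P(log t) would vanish only on a null set. -/
lemma eq_zero_of_logEval_ae_eq_zero {P : ℝ[X]}
    (h : ∀ᵐ t ∂(volume.restrict (Ioo (0 : ℝ) 1)), logEval P t = 0) : P = 0 := by
  by_contra hP
  have hfin : {t ∈ Ioo (0 : ℝ) 1 | logEval P t = 0}.Finite := by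
    refine Set.Finite.subset (P.roots.toFinset.finite_toSet.image Real.exp) ?_
    rintro t ⟨ht, h0⟩
    exact ⟨Real.log t, by simpa [hP] using (logEval_apply P t).symm.trans h0, Real.exp_log ht.1⟩
  rw [ae_restrict_iff' measurableSet_Ioo] at h
  have h2 : ∀ᵐ t : ℝ, t ∉ Ioo (0 : ℝ) 1 := by
    filter_upwards [h, hfin.measure_zero volume |> compl_mem_ae_iff.2] with t h1 h2 h3
    exact h2 ⟨h3, h1 h3⟩
  have h3 : volume (Ioo (0 : ℝ) 1) = 0 := by
    simpa only [ae_iff, not_not, ofPred_mem_eq] using h2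
  simp at h3

/-! ### Moment determinacy and density. -/

/-- Two finite measures under which `X` has exponential moments near `0` and the same moments push
forward to the same law. -/
lemma map_eq_map_of_moments {Ω : Type*} [MeasurableSpace Ω] {μ ν : Measure Ω} [IsFiniteMeasure μ]
    [IsFiniteMeasure ν] {X : Ω → ℝ} (hX : Measurable X)
    (hμ : 0 ∈ interior (integrableExpSet X μ)) (hν : 0 ∈ interior (integrableExpSet X ν))
    (h : ∀ n : ℕ, ∫ x, X x ^ n ∂μ = ∫ x, X x ^ n ∂ν) : μ.map X = ν.map X := by
  -- The Taylor coefficients of the moment generating function at 0 are the moments up to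
  -- factorials.
  have hmgf : mgf X μ =ᶠ[𝓝 0] mgf X ν := by
    have h1 := hasFPowerSeriesAt_mgf hμ
    have h2 := hasFPowerSeriesAt_mgf hν
    simp only [zero_mul, Real.exp_zero, mul_one, h] at h1 h2
    filter_upwards [h1.eventually_hasSum_sub, h2.eventually_hasSum_sub] with y hy1 hy2
    exact hy1.unique hy2
  set S := interior (integrableExpSet X μ) ∩ interior (integrableExpSet X ν) with hS
  have hconv : Convex ℝ S :=
    convex_integrableExpSet.interior.inter convex_integrableExpSet.interior
  -- The identity theorem on a vertical strip, which is connected; the strip contains the imaginary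
  -- axis, where the complex function is the characteristic function.
  have heq : EqOn (complexMGF X μ) (complexMGF X ν) {z | z.re ∈ S} := by
    refine AnalyticOnNhd.eqOn_of_preconnected_of_frequently_eq (z₀ := (0 : ℂ))
      (analyticOnNhd_complexMGF.mono fun z hz => hz.1)
      (analyticOnNhd_complexMGF.mono fun z hz => hz.2)
      (hconv.linear_preimage Complex.reLm).isPreconnected ⟨by simpa using hμ, by simpa using hν⟩ ?_
    have hreal : ∃ᶠ x : ℝ in 𝓝[≠] 0, complexMGF X μ x = complexMGF X ν x := by
      refine Eventually.frequently ?_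
      filter_upwards [hmgf.filter_mono nhdsWithin_le_nhds] with x hx
      rw [complexMGF_ofReal, complexMGF_ofReal, hx]
    have htend : Tendsto (fun x : ℝ => (x : ℂ)) (𝓝[≠] 0) (𝓝[≠] 0) := by
      refine tendsto_nhdsWithin_iff.2 ⟨?_, ?_⟩
      · exact (Complex.continuous_ofReal.tendsto' 0 0 (by simp)).mono_left nhdsWithin_le_nhds
      · filter_upwards [self_mem_nhdsWithin] with x hx
        simpa using hx
    exact htend.frequently hreal
  refine Measure.ext_of_charFun ?_
  ext t
  rw [← complexMGF_mul_I hX.aemeasurable, ← complexMGF_mul_I hX.aemeasurable]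
  exact heq ⟨by simpa using hμ, by simpa using hν⟩

lemma integrable_ofReal_withDensity_iff {Ω : Type*} [MeasurableSpace Ω] {μ : Measure Ω}
    {f g : Ω → ℝ} (hf : AEMeasurable f μ) :
    Integrable g (μ.withDensity fun x => ENNReal.ofReal (f x)) ↔
      Integrable (fun x => max (f x) 0 * g x) μ := by
  rw [integrable_withDensity_iff_integrable_smul₀' hf.ennreal_ofReal (by simp)]
  simp [ENNReal.toReal_ofReal']

lemma integral_ofReal_withDensity {Ω : Type*} [MeasurableSpace Ω] {μ : Measure Ω}
    {f g : Ω → ℝ} (hf : AEMeasurable f μ) :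
    ∫ x, g x ∂(μ.withDensity fun x => ENNReal.ofReal (f x)) = ∫ x, max (f x) 0 * g x ∂μ := by
  rw [integral_withDensity_eq_integral_toReal_smul₀ hf.ennreal_ofReal (by simp)]
  simp [ENNReal.toReal_ofReal']

lemma MemL2.max_zero {α β : ℝ} {f : ℝ → ℝ} (hf : MemL2 α β f) :
    MemL2 α β (fun t => max (f t) 0) := MemLp.pos_part hf

/-- Here e^{s log t} = t^s lies in L² as soon as s > -(β+1)/2, a neighbourhood of 0, and its product
with the positive part of f is then integrable. -/
lemma zero_mem_interior_integrableExpSet_log {α β : ℝ} (hα : -1 < α) (hβ : -1 < β) {f : ℝ → ℝ}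
    (hf : MemL2 α β f) :
    0 ∈ interior (integrableExpSet Real.log
      ((chiMeasure α β).withDensity fun t => ENNReal.ofReal (f t))) := by
  rw [mem_interior_iff_mem_nhds]
  filter_upwards [Ioi_mem_nhds (show -(β + 1) / 2 < 0 by linarith)] with s hs
  have hs' : -(β + 1) / 2 < s := hs
  rw [integrableExpSet, mem_ofPred_eq,
    integrable_ofReal_withDensity_iff hf.aestronglyMeasurable.aemeasurable]
  refine (hf.max_zero.integrable_mul
    (memL2_rpow (s := s) hα (by linarith : -1 < β + s * 2))).congr ?_
  filter_upwards [ae_mem_chiMeasure α β] with t ht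
  rw [Real.rpow_def_of_pos ht.1, mul_comm s]

lemma isFiniteMeasure_withDensity_of_memL2 {α β : ℝ} (hα : -1 < α) (hβ : -1 < β) {f : ℝ → ℝ}
    (hf : MemL2 α β f) :
    IsFiniteMeasure ((chiMeasure α β).withDensity fun t => ENNReal.ofReal (f t)) := by
  have := isFiniteMeasure_chiMeasure hα hβ
  exact isFiniteMeasure_withDensity_ofReal (hf.integrable one_le_two).2

/-- The functions `P (log t)` are dense in `L²_{χ^{α,β}}`. -/
lemma ae_eq_zero_of_inner2_logEval {α β : ℝ} (hα : -1 < α) (hβ : -1 < β) {f : ℝ → ℝ}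
    (hf : MemL2 α β f) (h : ∀ P : ℝ[X], inner2 α β f (logEval P) = 0) :
    f =ᵐ[chiMeasure α β] 0 := by
  have := isFiniteMeasure_chiMeasure hα hβ
  have hf' : MemL2 α β (fun t => -f t) := hf.neg
  have hm := hf.aestronglyMeasurable.aemeasurable
  have hm' := hf'.aestronglyMeasurable.aemeasurable
  have := isFiniteMeasure_withDensity_of_memL2 hα hβ hf
  have := isFiniteMeasure_withDensity_of_memL2 hα hβ hf'
  -- The positive and negative parts of f as densities; orthogonality to (log t)^n says that their
  -- moments agree.
  set μ := (chiMeasure α β).withDensity fun t => ENNReal.ofReal (f t) with hμ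
  set ν := (chiMeasure α β).withDensity fun t => ENNReal.ofReal (-f t) with hν
  have hmap : μ.map Real.log = ν.map Real.log := by
    refine map_eq_map_of_moments Real.measurable_log
      (zero_mem_interior_integrableExpSet_log hα hβ hf)
      (zero_mem_interior_integrableExpSet_log hα hβ hf') fun n => ?_
    rw [hμ, hν, integral_ofReal_withDensity hm, integral_ofReal_withDensity hm', ← sub_eq_zero]
    have hX : logEval (X ^ n) = fun t => Real.log t ^ n := by ext t; simp [logEval_apply]
    have hP := memL2_logEval hα hβ (X ^ n : ℝ[X])
    rw [hX] at hP
    rw [← integral_sub (hf.max_zero.integrable_mul hP) (hf'.max_zero.integrable_mul hP)]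
    refine Eq.trans (integral_congr_ae (ae_of_all _ fun t => ?_)) (h (X ^ n))
    simp only [hX, ← sub_mul, max_zero_sub_max_neg_zero_eq_self]
  -- On (0,1) log is inverted by exp, so the law of log t determines the measure.
  have hid : ∀ {κ : Measure ℝ}, κ ≪ chiMeasure α β → (κ.map Real.log).map Real.exp = κ := by
    intro κ hκ
    rw [Measure.map_map Real.measurable_exp Real.measurable_log]
    refine (Measure.map_congr (g := id) ?_).trans Measure.map_id
    filter_upwards [hκ.ae_le (ae_mem_chiMeasure α β)] with t ht
    exact Real.exp_log ht.1
  have heq : μ = ν := by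
    exact (hid (withDensity_absolutelyContinuous _ _)).symm.trans
      ((congrArg _ hmap).trans (hid (withDensity_absolutelyContinuous _ _)))
  have hae := (withDensity_eq_iff_of_sigmaFinite hm.ennreal_ofReal hm'.ennreal_ofReal).1 heq
  filter_upwards [hae] with t ht
  rcases le_total (f t) 0 with h0 | h0
  · rw [ENNReal.ofReal_of_nonpos h0, eq_comm, ENNReal.ofReal_eq_zero] at ht
    exact le_antisymm h0 (by simpa using ht)
  · rw [ENNReal.ofReal_of_nonpos (neg_nonpos.2 h0), ENNReal.ofReal_eq_zero] at ht
    exact le_antisymm ht h0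

/-! ### Weak derivatives on (0,1). -/

lemma locallyIntegrableOn_congr {f g : ℝ → ℝ} (hf : LocallyIntegrableOn f (Ioo 0 1))
    (h : f =ᵐ[volume.restrict (Ioo (0 : ℝ) 1)] g) : LocallyIntegrableOn g (Ioo 0 1) := by
  intro x hx
  obtain ⟨s, hs, hfs⟩ := hf x hx
  refine ⟨s ∩ Ioo 0 1, inter_mem hs self_mem_nhdsWithin, ?_⟩
  exact (hfs.mono_set inter_subset_left).congr_fun_ae
    (ae_restrict_of_ae_restrict_of_subset inter_subset_right h)

lemma IsWeakDeriv.congr {u v u' v' : ℝ → ℝ} (h : IsWeakDeriv u u')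
    (huv : u =ᵐ[volume.restrict (Ioo (0 : ℝ) 1)] v)
    (huv' : u' =ᵐ[volume.restrict (Ioo (0 : ℝ) 1)] v') : IsWeakDeriv v v' := by
  refine ⟨locallyIntegrableOn_congr h.1 huv, locallyIntegrableOn_congr h.2.1 huv',
    fun ψ h1 h2 h3 => ?_⟩
  have e1 : ∫ t in Ioo (0 : ℝ) 1, v t * deriv ψ t = ∫ t in Ioo (0 : ℝ) 1, u t * deriv ψ t :=
    integral_congr_ae (huv.mono fun t ht => by simp only [ht])
  have e2 : ∫ t in Ioo (0 : ℝ) 1, v' t * ψ t = ∫ t in Ioo (0 : ℝ) 1, u' t * ψ t :=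
    integral_congr_ae (huv'.mono fun t ht => by simp only [ht])
  rw [e1, e2, h.2.2 ψ h1 h2 h3]

lemma integrableOn_mul_of_tsupport_subset {f ψ : ℝ → ℝ} (hf : LocallyIntegrableOn f (Ioo 0 1))
    (hψ : Continuous ψ) (hc : HasCompactSupport ψ) (hs : tsupport ψ ⊆ Ioo 0 1) :
    IntegrableOn (fun t => f t * ψ t) (Ioo 0 1) := by
  have h1 : IntegrableOn (fun t => f t * ψ t) (tsupport ψ) :=
    (hf.integrableOn_compact_subset hs hc).mul_continuousOn hψ.continuousOn hc
  refine h1.of_forall_sdiff_eq_zero measurableSet_Ioo fun t ht => ?_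
  rw [image_eq_zero_of_notMem_tsupport ht.2, mul_zero]

lemma IsWeakDeriv.sub {u v u' v' : ℝ → ℝ} (hu : IsWeakDeriv u u') (hv : IsWeakDeriv v v') :
    IsWeakDeriv (u - v) (u' - v') := by
  refine ⟨hu.1.sub hv.1, hu.2.1.sub hv.2.1, fun ψ h1 h2 h3 => ?_⟩
  have hd : Continuous (deriv ψ) := h1.continuous_deriv (by simp)
  have hs : tsupport (deriv ψ) ⊆ Ioo 0 1 := (tsupport_deriv_subset (𝕜 := ℝ)).trans h3
  simp only [Pi.sub_apply, sub_mul]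
  rw [integral_sub (integrableOn_mul_of_tsupport_subset hu.1 hd h2.deriv hs)
      (integrableOn_mul_of_tsupport_subset hv.1 hd h2.deriv hs),
    integral_sub (integrableOn_mul_of_tsupport_subset hu.2.1 h1.continuous h2 h3)
      (integrableOn_mul_of_tsupport_subset hv.2.1 h1.continuous h2 h3),
    hu.2.2 ψ h1 h2 h3, hv.2.2 ψ h1 h2 h3]
  ring

/-- The difference v - w is a weak derivative of 0, so it integrates to 0 against every test
function. -/
lemma IsWeakDeriv.unique {u v w : ℝ → ℝ} (hv : IsWeakDeriv u v) (hw : IsWeakDeriv u w) :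
    v =ᵐ[volume.restrict (Ioo (0 : ℝ) 1)] w := by
  have h := isOpen_Ioo.ae_eq_zero_of_integral_contDiff_smul_eq_zero (hv.2.1.sub hw.2.1)
    (fun ψ h1 h2 h3 => by
      have h4 := (hv.sub hw).2.2 ψ h1 h2 h3
      simp only [sub_self, Pi.zero_apply, zero_mul, integral_zero] at h4
      rw [← setIntegral_eq_integral_of_forall_compl_eq_zero (s := Ioo 0 1)]
      · simpa [mul_comm] using h4
      · intro t ht
        rw [image_eq_zero_of_notMem_tsupport fun h => ht (h3 h), zero_smul])
  rw [EventuallyEq, ae_restrict_iff' measurableSet_Ioo]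
  filter_upwards [h] with t ht hmem
  exact sub_eq_zero.1 (ht hmem)

lemma hasDerivAt_logEval (P : ℝ[X]) {t : ℝ} (ht : t ≠ 0) :
    HasDerivAt (logEval P) (logEval (derivative P) t / t) t :=
  (P.hasDerivAt (Real.log t)).comp t (Real.hasDerivAt_log ht)

lemma continuousOn_logEval (P : ℝ[X]) : ContinuousOn (logEval P) (Ioo 0 1) := fun _ ht =>
  (hasDerivAt_logEval P ht.1.ne').continuousAt.continuousWithinAt

/-- Classical derivatives are weak derivatives. -/
lemma isWeakDeriv_of_hasDerivAt {f f' : ℝ → ℝ} (hf : ∀ t ∈ Ioo (0 : ℝ) 1, HasDerivAt f (f' t) t)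
    (hf' : ContinuousOn f' (Ioo 0 1)) : IsWeakDeriv f f' := by
  have hc : ContinuousOn f (Ioo 0 1) := fun t ht => (hf t ht).continuousAt.continuousWithinAt
  have l1 := hc.locallyIntegrableOn (μ := volume) measurableSet_Ioo
  have l2 := hf'.locallyIntegrableOn (μ := volume) measurableSet_Ioo
  refine ⟨l1, l2, fun ψ h1 h2 h3 => ?_⟩
  have hd : Continuous (deriv ψ) := h1.continuous_deriv (by simp)
  have hs : tsupport (deriv ψ) ⊆ Ioo 0 1 := (tsupport_deriv_subset (𝕜 := ℝ)).trans h3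
  have i0 := integrableOn_mul_of_tsupport_subset l1 h1.continuous h2 h3
  have i1 := integrableOn_mul_of_tsupport_subset l1 hd h2.deriv hs
  have i2 := integrableOn_mul_of_tsupport_subset l2 h1.continuous h2 h3
  have z : ∀ t, t ∉ Ioo (0 : ℝ) 1 → ψ t = 0 := fun t ht =>
    image_eq_zero_of_notMem_tsupport fun h => ht (h3 h)
  have z' : ∀ t, t ∉ Ioo (0 : ℝ) 1 → deriv ψ t = 0 := fun t ht =>
    image_eq_zero_of_notMem_tsupport fun h => ht (hs h)
  have key : ∫ t, (f' t * ψ t + f t * deriv ψ t) = 0 := by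
    refine integral_eq_zero_of_hasDerivAt_of_integrable (f := fun t => f t * ψ t)
      (fun t => ?_) ?_ ?_
    -- Nothing is known about f outside (0,1), but f ψ vanishes near every point off the support of
    -- ψ.
    · by_cases ht : t ∈ tsupport ψ
      · exact (hf t (h3 ht)).mul (h1.differentiable (by simp) t).hasDerivAt
      · have e : (fun t => f t * ψ t) =ᶠ[𝓝 t] fun _ => 0 := by
          filter_upwards [(isClosed_tsupport ψ).isOpen_compl.mem_nhds ht] with s hs
          rw [image_eq_zero_of_notMem_tsupport hs, mul_zero]
        rw [image_eq_zero_of_notMem_tsupport ht, image_eq_zero_of_notMem_tsupport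
          (fun h => ht (tsupport_deriv_subset (𝕜 := ℝ) h))]
        simpa using (hasDerivAt_const t (0 : ℝ)).congr_of_eventuallyEq e
    · refine (integrableOn_iff_integrable_of_support_subset (s := Ioo 0 1) ?_).1 (i2.add i1)
      intro t ht
      by_contra hn
      exact ht (by simp [z t hn, z' t hn])
    · refine (integrableOn_iff_integrable_of_support_subset (s := Ioo 0 1) ?_).1 i0
      intro t ht
      by_contra hn
      exact ht (by simp [z t hn])
  rw [← setIntegral_eq_integral_of_forall_compl_eq_zero (s := Ioo 0 1)
    (fun t ht => by simp [z t ht, z' t ht]), integral_add i2 i1] at key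
  linarith

lemma isWeakDeriv_logEval (P : ℝ[X]) :
    IsWeakDeriv (logEval P) (fun t => logEval (derivative P) t / t) :=
  isWeakDeriv_of_hasDerivAt (fun _ ht => hasDerivAt_logEval P ht.1.ne')
    ((continuousOn_logEval _).div continuousOn_id fun _ ht => ht.1.ne')

/-! ### Cutoff and integration by parts. -/

/-- Makes the cut-off weight an admissible test function: extension by zero is smooth on (0,1) and
on the complement of K, two open sets covering the line. -/
lemma contDiff_indicator_of_eq_zero {f : ℝ → ℝ} (hf : ContDiffOn ℝ ∞ f (Ioo 0 1)) {K : Set ℝ}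
    (hK : IsCompact K) (hK1 : K ⊆ Ioo 0 1) (h0 : ∀ t ∈ Ioo (0 : ℝ) 1, t ∉ K → f t = 0) :
    ContDiff ℝ ∞ ((Ioo (0 : ℝ) 1).indicator f) ∧ tsupport ((Ioo (0 : ℝ) 1).indicator f) ⊆ K := by
  have hz : ∀ t ∉ K, (Ioo (0 : ℝ) 1).indicator f t = 0 := by
    intro t ht
    by_cases h : t ∈ Ioo (0 : ℝ) 1
    · rw [indicator_of_mem h, h0 t h ht]
    · rw [indicator_of_notMem h]
  refine ⟨contDiff_of_contDiffOn_union_of_isOpen (s := Ioo 0 1) (t := Kᶜ) ?_ ?_ ?_ isOpen_Ioo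
    hK.isClosed.isOpen_compl, closure_minimal (fun t ht => ?_) hK.isClosed⟩
  · exact hf.congr fun t ht => indicator_of_mem ht _
  · exact (contDiffOn_const (c := (0 : ℝ))).congr fun t ht => hz t ht
  · rw [eq_univ_iff_forall]
    exact fun t => (em (t ∈ K)).imp (fun h => hK1 h) id
  · by_contra h
    exact ht (hz t h)

/-- A smooth function that is `1` near `0` and vanishes off `[-2, 2]`. -/
noncomputable def cutoff : ContDiffBump (0 : ℝ) := ⟨1, 2, one_pos, one_lt_two⟩

lemma cutoff_eq_zero {x : ℝ} (hx : 2 < |x|) : cutoff x = 0 :=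
  cutoff.zero_of_le_dist (by simpa [cutoff] using hx.le)

lemma exists_abs_deriv_cutoff_le : ∃ C : ℝ, ∀ x, |deriv cutoff x| ≤ C := by
  have h : HasCompactSupport (deriv cutoff) := cutoff.hasCompactSupport.deriv
  exact h.exists_bound_of_continuous (cutoff.contDiff.continuous_deriv (n := 1) le_rfl)

/-- The adjoint of `t ∂ₜ` with respect to `χ^{α,β}` and `χ^{α+1,β}`, acting on the polynomial `P`
that stands for `P (log t)`. -/
noncomputable def adjPoly (α β : ℝ) (P : ℝ[X]) : ℝ[X] :=
  C (α + 1) * P + C (β + 1) * (X * P) + X * derivative P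

/-- The cutoff function in the variable `log (-log t)`, scaled by `n + 1`. -/
noncomputable def logCutoff (n : ℕ) (t : ℝ) : ℝ := Real.log (-Real.log t) / (n + 1)

lemma neg_log_pos {t : ℝ} (ht : t ∈ Ioo (0 : ℝ) 1) : 0 < -Real.log t :=
  neg_pos.2 (Real.log_neg ht.1 ht.2)

lemma hasDerivAt_logCutoff (n : ℕ) {t : ℝ} (ht : t ∈ Ioo (0 : ℝ) 1) :
    HasDerivAt (logCutoff n) (1 / (t * Real.log t * (n + 1))) t := by
  have h := (((Real.hasDerivAt_log ht.1.ne').neg).log (neg_log_pos ht).ne').div_const ((n : ℝ) + 1)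
  refine h.congr_deriv ?_
  have := ht.1.ne'
  have := neg_ne_zero.1 (neg_log_pos ht).ne'
  simp only [Pi.neg_apply]
  field_simp

lemma contDiffOn_logCutoff (n : ℕ) : ContDiffOn ℝ ∞ (logCutoff n) (Ioo 0 1) := by
  unfold logCutoff
  refine ContDiffOn.div_const (ContDiffOn.log (ContDiffOn.neg (ContDiffOn.log contDiffOn_id
    fun t ht => ht.1.ne')) fun t ht => (neg_log_pos ht).ne') _

/-- This computation dictates the form of `adjPoly`. -/
lemma hasDerivAt_mul_chi (α β : ℝ) (P : ℝ[X]) {t : ℝ} (ht : t ∈ Ioo (0 : ℝ) 1) :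
    HasDerivAt (fun t => t * chi (α + 1) β t * logEval P t)
      (-(chi α β t * logEval (adjPoly α β P) t)) t := by
  have hL := neg_log_pos ht
  have h1 : HasDerivAt (fun t => (-Real.log t) ^ (α + 1))
      (-t⁻¹ * (α + 1) * (-Real.log t) ^ (α + 1 - 1)) t :=
    ((Real.hasDerivAt_log ht.1.ne').neg).rpow_const (Or.inl hL.ne')
  have h2 : HasDerivAt (fun t : ℝ => t ^ β) (β * t ^ (β - 1)) t :=
    Real.hasDerivAt_rpow_const (Or.inl ht.1.ne')
  have h := ((hasDerivAt_id t).mul (h1.mul h2)).mul (hasDerivAt_logEval P ht.1.ne')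
  refine h.congr_deriv ?_
  have e1 : (-Real.log t) ^ (α + 1) = (-Real.log t) ^ α * (-Real.log t) :=
    Real.rpow_add_one hL.ne' α
  have e2 : t ^ (β - 1) = t ^ β / t := Real.rpow_sub_one ht.1.ne' β
  simp only [Pi.mul_apply, id, chi, adjPoly, eval_add, logEval_apply, eval_mul,
    eval_C, eval_X, add_sub_cancel_right, e1, e2]
  have := ht.1.ne'
  field_simp
  ring

lemma contDiffOn_mul_chi (α β : ℝ) (P : ℝ[X]) :
    ContDiffOn ℝ ∞ (fun t => t * chi (α + 1) β t * logEval P t) (Ioo 0 1) := by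
  have hl : ContDiffOn ℝ ∞ Real.log (Ioo 0 1) := contDiffOn_id.log fun t ht => ht.1.ne'
  refine (contDiffOn_id.mul (ContDiffOn.mul ?_ ?_)).mul ?_
  · exact hl.neg.rpow_const_of_ne fun t ht => (neg_log_pos ht).ne'
  · exact contDiffOn_id.rpow_const_of_ne fun t ht => ht.1.ne'
  · exact (P.contDiff_aeval (𝕜 := ℝ) ∞).comp_contDiffOn hl

/-- Integration by parts against `P (log t)` with the cutoff. -/
lemma integral_mul_cutoff {u u' : ℝ → ℝ} (h : IsWeakDeriv u u') (α β : ℝ) (P : ℝ[X]) (n : ℕ) :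
    ∫ t, (t * u' t) * (cutoff (logCutoff n t) * logEval P t) ∂chiMeasure (α + 1) β =
      ∫ t, u t * (cutoff (logCutoff n t) * logEval (adjPoly α β P) t +
        deriv cutoff (logCutoff n t) * logEval P t / (n + 1)) ∂chiMeasure α β := by
  set F : ℝ → ℝ := fun t => cutoff (logCutoff n t) * (t * chi (α + 1) β t * logEval P t) with hF
  -- The cutoff vanishes unless |log(-log t)| ≤ 2(n+1), that is, e^{-R} ≤ -log t ≤ e^R, which is a
  -- compact interval of t in (0,1).
  set R : ℝ := 2 * (n + 1) with hR
  have hn : (0 : ℝ) < n + 1 := by positivity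
  have hK : Icc (Real.exp (-Real.exp R)) (Real.exp (-Real.exp (-R))) ⊆ Ioo 0 1 := fun t ht =>
    ⟨(Real.exp_pos _).trans_le ht.1, ht.2.trans_lt (by simp [Real.exp_pos])⟩
  have h0 : ∀ t ∈ Ioo (0 : ℝ) 1,
      t ∉ Icc (Real.exp (-Real.exp R)) (Real.exp (-Real.exp (-R))) → F t = 0 := by
    intro t ht hnot
    have hb : 2 < |logCutoff n t| := by
      by_contra! hle
      refine hnot ?_
      rw [logCutoff, abs_div, abs_of_pos hn, div_le_iff₀ hn, abs_le,
        Real.le_log_iff_exp_le (neg_log_pos ht), Real.log_le_iff_le_exp (neg_log_pos ht)] at hle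
      rw [mem_Icc, ← Real.le_log_iff_exp_le ht.1, ← Real.log_le_iff_le_exp ht.1]
      constructor <;> linarith [hle.1, hle.2]
    simp only [hF, cutoff_eq_zero hb, zero_mul]
  have hsm : ContDiffOn ℝ ∞ F (Ioo 0 1) :=
    (cutoff.contDiff.comp_contDiffOn (contDiffOn_logCutoff n)).mul (contDiffOn_mul_chi α β P)
  obtain ⟨c1, c2⟩ := contDiff_indicator_of_eq_zero hsm isCompact_Icc hK h0
  have key := h.2.2 _ c1 (isCompact_Icc.of_isClosed_subset (isClosed_tsupport _) c2) (c2.trans hK)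
  rw [integral_chiMeasure, integral_chiMeasure]
  have e1 : ∫ t in Ioo (0 : ℝ) 1, u' t * (Ioo (0 : ℝ) 1).indicator F t =
      ∫ t in Ioo (0 : ℝ) 1, chi (α + 1) β t *
        ((t * u' t) * (cutoff (logCutoff n t) * logEval P t)) := by
    refine setIntegral_congr_fun measurableSet_Ioo fun t ht => ?_
    simp only [indicator_of_mem ht, hF]
    ring
  have e2 : ∫ t in Ioo (0 : ℝ) 1, u t * deriv ((Ioo (0 : ℝ) 1).indicator F) t =
      -∫ t in Ioo (0 : ℝ) 1, chi α β t * (u t * (cutoff (logCutoff n t) *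
        logEval (adjPoly α β P) t + deriv cutoff (logCutoff n t) * logEval P t / (n + 1))) := by
    rw [← integral_neg]
    refine setIntegral_congr_fun measurableSet_Ioo fun t ht => ?_
    have e3 : (Ioo (0 : ℝ) 1).indicator F =ᶠ[𝓝 t] F := by
      filter_upwards [isOpen_Ioo.mem_nhds ht] with s hs
      exact indicator_of_mem hs _
    have hc : HasDerivAt cutoff (deriv cutoff (logCutoff n t)) (logCutoff n t) :=
      (cutoff.contDiff (n := 1)).differentiable one_ne_zero _ |>.hasDerivAt
    have hd := (hc.comp t (hasDerivAt_logCutoff n ht)).mul (hasDerivAt_mul_chi α β P ht)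
    have e4 : deriv F t = _ := hd.deriv
    -- The factor -log t gained from weight α to α+1 cancels the log t in the derivative of
    -- `logCutoff`, leaving only 1/(n+1).
    simp only [e3.deriv_eq, e4, Function.comp, chi_add_one α β ht]
    have := ht.1.ne'
    have := neg_ne_zero.1 (neg_log_pos ht).ne'
    field_simp
    ring
  rw [← e1, ← neg_eq_iff_eq_neg.2 e2, key, neg_neg]

/-- Integration by parts against `P (log t)`; there is no boundary term. -/
lemma inner2_mul_logEval {u u' : ℝ → ℝ} {α β : ℝ} (hα : -1 < α) (hβ : -1 < β)
    (h : IsWeakDeriv u u') (hu : MemL2 α β u) (hu' : MemL2 (α + 1) β (fun t => t * u' t))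
    (P : ℝ[X]) :
    inner2 (α + 1) β (fun t => t * u' t) (logEval P) =
      inner2 α β u (logEval (adjPoly α β P)) := by
  obtain ⟨C, hC⟩ := exists_abs_deriv_cutoff_le
  have hC0 : 0 ≤ C := (abs_nonneg _).trans (hC 0)
  have hlim : ∀ t, Tendsto (fun n : ℕ => logCutoff n t) atTop (𝓝 0) := fun t => by
    unfold logCutoff
    simpa [div_eq_mul_inv] using tendsto_one_div_add_atTop_nhds_zero_nat.const_mul
      (Real.log (-Real.log t))
  have hone : ∀ t, Tendsto (fun n : ℕ => cutoff (logCutoff n t)) atTop (𝓝 1) := fun t => by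
    have h1 : cutoff (0 : ℝ) = 1 := cutoff.one_of_mem_closedBall (by simp [cutoff])
    simpa only [h1, Function.comp_def] using (cutoff.continuous.tendsto 0).comp (hlim t)
  have hmeas : ∀ n, Measurable (logCutoff n) := fun n => by unfold logCutoff; fun_prop
  have hcm : Measurable cutoff := cutoff.continuous.measurable
  have hP := memL2_logEval (show -1 < α + 1 by linarith) hβ P
  have i1 := hu'.integrable_mul hP
  have i2 := hu.integrable_mul (memL2_logEval hα hβ (adjPoly α β P))
  have i3 := hu.integrable_mul (memL2_logEval hα hβ P)
  have t1 : Tendsto (fun n : ℕ => ∫ t, (t * u' t) * (cutoff (logCutoff n t) * logEval P t)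
      ∂chiMeasure (α + 1) β) atTop (𝓝 (inner2 (α + 1) β (fun t => t * u' t) (logEval P))) := by
    refine tendsto_integral_of_dominated_convergence
      (fun t => |t * u' t * logEval P t|) (fun n => ?_) i1.abs (fun n => ?_) ?_
    · exact hu'.aestronglyMeasurable.mul
        ((hcm.comp (hmeas n)).mul (measurable_logEval P)).aestronglyMeasurable
    · refine ae_of_all _ fun t => ?_
      rw [Real.norm_eq_abs, mul_left_comm, abs_mul]
      refine mul_le_of_le_one_left (abs_nonneg _) ?_
      rw [abs_of_nonneg cutoff.nonneg]
      exact cutoff.le_one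
    · refine ae_of_all _ fun t => ?_
      simpa using ((hone t).mul_const (logEval P t)).const_mul (t * u' t)
  have t2 : Tendsto (fun n : ℕ => ∫ t, u t * (cutoff (logCutoff n t) *
      logEval (adjPoly α β P) t + deriv cutoff (logCutoff n t) * logEval P t / (n + 1))
      ∂chiMeasure α β) atTop (𝓝 (inner2 α β u (logEval (adjPoly α β P)))) := by
    -- The cutoff term is at most C |u P(log t)| uniformly in n, and tends to 0 pointwise through
    -- the factor 1/(n+1).
    refine tendsto_integral_of_dominated_convergence
      (fun t => |u t * logEval (adjPoly α β P) t| + C * |u t * logEval P t|) (fun n => ?_)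
      (i2.abs.add (i3.abs.const_mul C)) (fun n => ?_) ?_
    · refine hu.aestronglyMeasurable.mul (Measurable.aestronglyMeasurable ?_)
      exact ((hcm.comp (hmeas n)).mul (measurable_logEval _)).add
        ((((measurable_deriv _).comp (hmeas n)).mul (measurable_logEval P)).div_const _)
    · refine ae_of_all _ fun t => ?_
      rw [Real.norm_eq_abs, mul_add]
      refine (abs_add_le _ _).trans (add_le_add ?_ ?_)
      · rw [mul_left_comm, abs_mul]
        refine mul_le_of_le_one_left (abs_nonneg _) ?_
        rw [abs_of_nonneg cutoff.nonneg]
        exact cutoff.le_one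
      · rw [mul_div_assoc, mul_left_comm, abs_mul, ← mul_div_assoc, abs_div]
        refine mul_le_mul (hC _) (div_le_self (abs_nonneg _) ?_) (by positivity) hC0
        rw [abs_of_pos (by positivity)]
        simp
    · refine ae_of_all _ fun t => ?_
      have hz : Tendsto (fun n : ℕ => deriv cutoff (logCutoff n t) * logEval P t / (n + 1))
          atTop (𝓝 0) := by
        have hd : Continuous (deriv cutoff) :=
          cutoff.contDiff.continuous_deriv (n := 1) le_rfl
        have h5 := (((hd.tendsto 0).comp (hlim t)).mul_const (logEval P t)).mul
          (tendsto_one_div_add_atTop_nhds_zero_nat (𝕜 := ℝ))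
        simpa [div_eq_mul_inv, Function.comp_def] using h5
      simpa using (((hone t).mul_const (logEval (adjPoly α β P) t)).add hz).const_mul (u t)
  simp only [integral_mul_cutoff h α β P] at t1
  exact tendsto_nhds_unique t1 t2

/-! ### Inner product calculus. -/

section Inner

variable {α β : ℝ} {u v w : ℝ → ℝ}

lemma inner2_comm (α β : ℝ) (u v : ℝ → ℝ) : inner2 α β u v = inner2 α β v u := by
  simp only [inner2, mul_comm]

lemma inner2_self_nonneg (α β : ℝ) (u : ℝ → ℝ) : 0 ≤ inner2 α β u u :=
  integral_nonneg fun t => mul_self_nonneg (u t)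

lemma inner2_sub_left (hu : MemL2 α β u) (hv : MemL2 α β v) (hw : MemL2 α β w) :
    inner2 α β (u - v) w = inner2 α β u w - inner2 α β v w := by
  simp only [inner2, Pi.sub_apply, sub_mul]
  exact integral_sub (hu.integrable_mul hw) (hv.integrable_mul hw)

lemma inner2_sub_right (hu : MemL2 α β u) (hv : MemL2 α β v) (hw : MemL2 α β w) :
    inner2 α β w (u - v) = inner2 α β w u - inner2 α β w v := by
  rw [inner2_comm, inner2_sub_left hu hv hw, inner2_comm, inner2_comm _ _ v]

lemma inner2_smul_right (c : ℝ) (u v : ℝ → ℝ) :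
    inner2 α β u (c • v) = c * inner2 α β u v := by
  simp only [inner2, Pi.smul_apply, smul_eq_mul, mul_left_comm _ c]
  exact integral_const_mul _ _

lemma inner2_sub_self (hu : MemL2 α β u) (hv : MemL2 α β v) :
    inner2 α β (u - v) (u - v) =
      inner2 α β u u - 2 * inner2 α β u v + inner2 α β v v := by
  rw [inner2_sub_left hu hv (hu.sub hv), inner2_sub_right hu hv hu, inner2_sub_right hu hv hv,
    inner2_comm _ _ v u]
  ring

lemma inner2_congr {u' v' : ℝ → ℝ} (hu : u =ᵐ[chiMeasure α β] u')
    (hv : v =ᵐ[chiMeasure α β] v') : inner2 α β u v = inner2 α β u' v' := by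
  refine integral_congr_ae ?_
  filter_upwards [hu, hv] with t h1 h2
  rw [h1, h2]

/-- The class of `u` in `L²_{χ^{α,β}}`. -/
noncomputable def MemL2.toL2 (hu : MemL2 α β u) : Lp ℝ 2 (chiMeasure α β) :=
  MemLp.toLp u (show MemLp u 2 (chiMeasure α β) from hu)

lemma MemL2.sub (hu : MemL2 α β u) (hv : MemL2 α β v) : MemL2 α β (u - v) := MemLp.sub hu hv

lemma MemL2.toL2_congr (hu : MemL2 α β u) (hv : MemL2 α β v) (h : u = v) : hu.toL2 = hv.toL2 := by
  subst h; rfl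

lemma MemL2.coeFn_toL2 (hu : MemL2 α β u) : (hu.toL2 : ℝ → ℝ) =ᵐ[chiMeasure α β] u :=
  MemLp.coeFn_toLp _

lemma inner_toL2 (hu : MemL2 α β u) (hv : MemL2 α β v) :
    inner ℝ hu.toL2 hv.toL2 = inner2 α β u v := by
  rw [L2.inner_def]
  refine integral_congr_ae ?_
  filter_upwards [hu.coeFn_toL2, hv.coeFn_toL2] with t h1 h2
  simp [h1, h2, mul_comm]

lemma norm2_sq (hu : MemL2 α β u) : norm2 α β u ^ 2 = inner2 α β u u := by
  rw [← inner_toL2 hu hu, real_inner_self_eq_norm_sq, MemL2.toL2, Lp.norm_toLp, norm2]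

lemma norm2_nonneg (α β : ℝ) (u : ℝ → ℝ) : 0 ≤ norm2 α β u := ENNReal.toReal_nonneg

end Inner

/-! ### Orthogonal projections and their convergence. -/

section Projection

variable {α β : ℝ}

lemma inner2_logEval_self_eq_zero (hα : -1 < α) (hβ : -1 < β) {P : ℝ[X]}
    (h : inner2 α β (logEval P) (logEval P) = 0) : P = 0 := by
  refine eq_zero_of_logEval_ae_eq_zero ((ae_chiMeasure (α := α) (β := β)).1 ?_)
  have h1 := (integral_eq_zero_iff_of_nonneg (fun t => mul_self_nonneg (logEval P t))
    ((memL2_logEval hα hβ P).integrable_mul (memL2_logEval hα hβ P))).1 h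
  filter_upwards [h1] with t ht
  exact mul_self_eq_zero.1 ht

/-- The class of `P (log t)` in `L²_{χ^{α,β}}`. -/
noncomputable def logEvalLp (hα : -1 < α) (hβ : -1 < β) :
    ℝ[X] →ₗ[ℝ] Lp ℝ 2 (chiMeasure α β) where
  toFun P := (memL2_logEval hα hβ P).toL2
  map_add' P Q := (MemL2.toL2_congr _ (MemLp.add (memL2_logEval hα hβ P) (memL2_logEval hα hβ Q))
    (map_add _ _ _)).trans <| MemLp.toLp_add (memL2_logEval hα hβ P) (memL2_logEval hα hβ Q)
  map_smul' c P := (MemL2.toL2_congr _ (MemLp.const_smul (memL2_logEval hα hβ P) c)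
    (map_smul _ _ _)).trans <| MemLp.toLp_const_smul c (memL2_logEval hα hβ P)

instance finiteDimensional_degreeLT (n : ℕ) : FiniteDimensional ℝ (degreeLT ℝ n) :=
  Module.Finite.equiv (degreeLTEquiv ℝ n).symm

lemma degreeLT_mono' {m n : ℕ} (h : m ≤ n) : degreeLT ℝ m ≤ degreeLT ℝ n := fun P hP => by
  rw [mem_degreeLT] at hP ⊢
  exact hP.trans_le (by exact_mod_cast h)

/-- The orthogonal projections onto polynomials of degree `< n` in `log t`; they converge. -/
lemma exists_projections (hα : -1 < α) (hβ : -1 < β) {v : ℝ → ℝ} (hv : MemL2 α β v) :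
    ∃ Q : ℕ → ℝ[X], (∀ n, Q n ∈ degreeLT ℝ n) ∧
      (∀ n, ∀ P ∈ degreeLT ℝ n, inner2 α β (v - logEval (Q n)) (logEval P) = 0) ∧
      Tendsto (fun n => inner2 α β (v - logEval (Q n)) (v - logEval (Q n))) atTop (𝓝 0) := by
  set U : ℕ → Submodule ℝ (Lp ℝ 2 (chiMeasure α β)) :=
    fun n => (degreeLT ℝ n).map (logEvalLp hα hβ) with hU
  have hfin : ∀ n, FiniteDimensional ℝ (U n) := fun n => by
    rw [hU]; infer_instance
  set x := hv.toL2 with hx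
  have hmem : ∀ n, ∃ P ∈ degreeLT ℝ n, logEvalLp hα hβ P = (U n).starProjection x := fun n =>
    Submodule.mem_map.1 ((U n).starProjection_apply_mem x)
  choose Q hQ hQx using hmem
  have hsub : ∀ n, x - (U n).starProjection x =
      MemL2.toL2 (u := v - logEval (Q n)) (hv.sub (memL2_logEval hα hβ (Q n))) := fun n => by
    rw [← hQx]
    exact (MemLp.toLp_sub hv (memL2_logEval hα hβ (Q n))).symm
  refine ⟨Q, hQ, fun n P hP => ?_, ?_⟩
  · rw [← inner_toL2 (hv.sub (memL2_logEval hα hβ (Q n))) (memL2_logEval hα hβ P), ← hsub,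
      real_inner_comm]
    exact (Submodule.mem_orthogonal _ _).1 ((U n).sub_starProjection_mem_orthogonal x) _
      (Submodule.mem_map_of_mem (f := logEvalLp hα hβ) hP)
  · have hmono : Monotone U := fun m n hmn => Submodule.map_mono (degreeLT_mono' hmn)
    -- Density amounts to a trivial orthogonal complement, which is the moment argument.
    have hdense : ⊤ ≤ (⨆ n, U n).topologicalClosure := by
      refine ((Submodule.topologicalClosure_eq_top_iff).2 ?_).ge
      rw [eq_bot_iff]
      intro f hf
      have hf2 : MemL2 α β f := Lp.memLp f
      have h0 : (f : ℝ → ℝ) =ᵐ[chiMeasure α β] 0 := by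
        refine ae_eq_zero_of_inner2_logEval hα hβ hf2 fun P => ?_
        have hff : hf2.toL2 = f := Lp.toLp_coeFn f hf2
        rw [← inner_toL2 hf2 (memL2_logEval hα hβ P), hff, real_inner_comm]
        refine (Submodule.mem_orthogonal _ _).1 hf _ (Submodule.mem_iSup_of_mem (P.natDegree + 1)
          (Submodule.mem_map_of_mem (f := logEvalLp hα hβ) ?_))
        rw [mem_degreeLT]
        exact degree_le_natDegree.trans_lt (by exact_mod_cast Nat.lt_succ_self _)
      exact (Submodule.mem_bot ℝ).2 (Lp.eq_zero_iff_ae_eq_zero.2 h0)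
    have ht := Submodule.starProjection_tendsto_self U hmono x hdense
    have ht2 := ((tendsto_const_nhds (x := x)).sub ht).norm.pow 2
    rw [sub_self, norm_zero, zero_pow two_ne_zero] at ht2
    refine ht2.congr fun n => ?_
    rw [hsub, ← real_inner_self_eq_norm_sq, inner_toL2]

end Projection

/-! ### The spectral gap. -/

section SpectralGap

variable {α β : ℝ}

/-- Only the multiplication by X raises the degree. The truncated n - 1 is harmless at n = 0, where
both spaces are zero. -/
lemma adjPoly_mem_degreeLT {P : ℝ[X]} {n : ℕ} (hP : P ∈ degreeLT ℝ (n - 1)) :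
    adjPoly α β P ∈ degreeLT ℝ n := by
  rcases n with _ | n
  · have : P = 0 := by simpa [mem_degreeLT] using hP
    simp [this, adjPoly]
  · rw [Nat.add_sub_cancel, mem_degreeLT, degree_lt_iff_coeff_zero] at hP
    rw [mem_degreeLT, degree_lt_iff_coeff_zero]
    intro k hk
    obtain ⟨k, rfl⟩ : ∃ l, k = l + 1 := ⟨k - 1, by omega⟩
    simp only [adjPoly, coeff_add, coeff_C_mul, coeff_X_mul, coeff_derivative,
      hP (k + 1) (by omega), hP k (by omega)]
    simp

lemma derivative_mem_degreeLT {P : ℝ[X]} {n : ℕ} (hP : P ∈ degreeLT ℝ n) :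
    derivative P ∈ degreeLT ℝ (n - 1) := by
  rw [mem_degreeLT, degree_lt_iff_coeff_zero] at hP ⊢
  intro k hk
  rw [coeff_derivative, hP (k + 1) (by omega), zero_mul]

lemma adjPoly_derivative_mem {P : ℝ[X]} {n : ℕ} (hP : P ∈ degreeLT ℝ n) :
    adjPoly α β (derivative P) ∈ degreeLT ℝ n :=
  adjPoly_mem_degreeLT (derivative_mem_degreeLT hP)

/-- Source of the eigenvalue: in D*D P only (β+1) X P' reaches degree n, with leading coefficient
n(β+1) times that of P. -/
lemma adjPoly_derivative_sub_mem {P : ℝ[X]} {n : ℕ} (hP : P ∈ degreeLT ℝ (n + 1)) :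
    adjPoly α β (derivative P) - C (n * (β + 1)) * P ∈ degreeLT ℝ n := by
  rw [mem_degreeLT, degree_lt_iff_coeff_zero] at hP ⊢
  intro k hk
  rcases Nat.eq_zero_or_pos k with rfl | hk0
  · obtain rfl : n = 0 := by omega
    simp [adjPoly, coeff_derivative, hP 1 (by omega)]
  · obtain ⟨l, rfl⟩ : ∃ l, k = l + 1 := ⟨k - 1, by omega⟩
    simp only [adjPoly, coeff_add, coeff_sub, coeff_C_mul, coeff_X_mul, coeff_derivative,
      hP (l + 1 + 1) (by omega)]
    rcases hk.eq_or_lt with h | h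
    · rw [h]; push_cast; ring
    · rw [hP (l + 1) (by omega)]; ring

lemma inner2_derivative_logEval (hα : -1 < α) (hβ : -1 < β) (P Q : ℝ[X]) :
    inner2 (α + 1) β (logEval (derivative P)) (logEval Q) =
      inner2 α β (logEval P) (logEval (adjPoly α β Q)) := by
  have he : (fun t => t * (logEval (derivative P) t / t)) =ᵐ[chiMeasure (α + 1) β]
      logEval (derivative P) := by
    filter_upwards [ae_mem_chiMeasure (α + 1) β] with t ht
    exact mul_div_cancel₀ _ ht.1.ne'
  rw [← inner2_mul_logEval hα hβ (isWeakDeriv_logEval P) (memL2_logEval hα hβ P)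
    ((memLp_congr_ae he).2 (memL2_logEval (by linarith) hβ _)) Q]
  exact inner2_congr he.symm (ae_eq_refl _)

/-- The spectral gap on polynomials in `log t`. -/
lemma spectralGap_logEval (hα : -1 < α) (hβ : -1 < β) (N n : ℕ) :
    ∀ q ∈ degreeLT ℝ n, (∀ P ∈ degreeLT ℝ N, inner2 α β (logEval q) (logEval P) = 0) →
      N * (β + 1) * inner2 α β (logEval q) (logEval q) ≤
        inner2 (α + 1) β (logEval (derivative q)) (logEval (derivative q)) := by
  have hα' : -1 < α + 1 := by linarith
  have hm := fun P => memL2_logEval hα hβ P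
  have hm' := fun P => memL2_logEval hα' hβ P
  induction n with
  | zero =>
    intro q hq _
    have : q = 0 := by simpa [mem_degreeLT] using hq
    simp [this, inner2]
  | succ n ih =>
    intro q hq horth
    rcases lt_or_ge n N with hn | hn
    -- Here q is orthogonal to itself.
    · rw [horth q (degreeLT_mono' hn hq), mul_zero]
      exact inner2_self_nonneg _ _ _
    · obtain ⟨Q, hQ, hQo, -⟩ := exists_projections hα hβ (hm q)
      -- The component r of q orthogonal to degrees < n behaves as an eigenvector: ⟨Dr, Dr⟩ = ⟨r,
      -- D*Dr⟩ = n(β+1)⟨r, r⟩. The cross terms vanish because D*D preserves degrees < n.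
      obtain ⟨r, hr⟩ : ∃ r, r = q - Q n := ⟨_, rfl⟩
      have hqr : Q n = q - r := by rw [hr]; ring
      have hrmem : r ∈ degreeLT ℝ (n + 1) := hr ▸
        Submodule.sub_mem _ hq (degreeLT_mono' n.le_succ (hQ n))
      have hro : ∀ P ∈ degreeLT ℝ n, inner2 α β (logEval r) (logEval P) = 0 := fun P hP => by
        rw [hr, map_sub]; exact hQo n P hP
      have hQr : inner2 α β (logEval (Q n)) (logEval r) = 0 := by
        rw [inner2_comm]; exact hro _ (hQ n)
      have h1 := ih (Q n) (hQ n) fun P hP => by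
        rw [hqr, map_sub, inner2_sub_left (hm q) (hm r) (hm P), horth P hP,
          hro P (degreeLT_mono' hn hP), sub_zero]
      have e1 : inner2 α β (logEval q) (logEval q) =
          inner2 α β (logEval (Q n)) (logEval (Q n)) + inner2 α β (logEval r) (logEval r) := by
        have h := inner2_sub_self (hm q) (hm r)
        rw [← map_sub, ← hqr] at h
        have h' : inner2 α β (logEval q) (logEval r) = inner2 α β (logEval r) (logEval r) := by
          rw [hqr, map_sub, inner2_sub_left (hm q) (hm r) (hm r)] at hQr
          linarith
        rw [h, h']; ring
      have hcross : inner2 (α + 1) β (logEval (derivative r)) (logEval (derivative (Q n))) = 0 := by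
        rw [inner2_derivative_logEval hα hβ]
        exact hro _ (adjPoly_derivative_mem (hQ n))
      have hrr : inner2 (α + 1) β (logEval (derivative r)) (logEval (derivative r)) =
          n * (β + 1) * inner2 α β (logEval r) (logEval r) := by
        rw [inner2_derivative_logEval hα hβ]
        have h := hro _ (adjPoly_derivative_sub_mem (α := α) (β := β) hrmem)
        rw [map_sub, inner2_sub_right (hm _) (hm _) (hm _), C_mul', map_smul,
          inner2_smul_right] at h
        linarith
      have e2 : inner2 (α + 1) β (logEval (derivative q)) (logEval (derivative q)) =
          inner2 (α + 1) β (logEval (derivative (Q n))) (logEval (derivative (Q n))) +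
            inner2 (α + 1) β (logEval (derivative r)) (logEval (derivative r)) := by
        have h := inner2_sub_self (hm' (derivative q)) (hm' (derivative r))
        rw [← map_sub, ← derivative_sub, ← hqr] at h
        have h' : inner2 (α + 1) β (logEval (derivative q)) (logEval (derivative r)) =
            inner2 (α + 1) β (logEval (derivative r)) (logEval (derivative r)) := by
          rw [hqr, derivative_sub, map_sub, inner2_sub_right (hm' _) (hm' _) (hm' _),
            inner2_comm _ _ (logEval (derivative r))] at hcross
          linarith
        rw [h, h']; ring
      rw [e1, e2, hrr, mul_add]
      have hb : 0 < β + 1 := by linarith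
      have hnN : (N : ℝ) ≤ n := by exact_mod_cast hn
      gcongr
      exact inner2_self_nonneg _ _ _

/-- The spectral gap: a function orthogonal to all polynomials of degree `< N` in `log t` is
controlled by its pseudo-derivative. -/
lemma spectralGap {v v' : ℝ → ℝ} (hα : -1 < α) (hβ : -1 < β) (N : ℕ) (h : IsWeakDeriv v v')
    (hv : MemL2 α β v) (hv' : MemL2 (α + 1) β (fun t => t * v' t))
    (horth : ∀ P ∈ degreeLT ℝ N, inner2 α β v (logEval P) = 0) :
    N * (β + 1) * inner2 α β v v ≤
      inner2 (α + 1) β (fun t => t * v' t) (fun t => t * v' t) := by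
  have hα' : -1 < α + 1 := by linarith
  have hm := fun P => memL2_logEval hα hβ P
  have hm' := fun P => memL2_logEval hα' hβ P
  obtain ⟨Q, hQ, hQo, hlim⟩ := exists_projections hα hβ hv
  have hvQ : ∀ n, ∀ P ∈ degreeLT ℝ n,
      inner2 α β v (logEval P) = inner2 α β (logEval (Q n)) (logEval P) := fun n P hP => by
    have := hQo n P hP
    rw [inner2_sub_left hv (hm _) (hm _)] at this
    linarith
  have hbound : ∀ n, N ≤ n → N * (β + 1) * inner2 α β (logEval (Q n)) (logEval (Q n)) ≤
      inner2 (α + 1) β (fun t => t * v' t) (fun t => t * v' t) := fun n hn => by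
    refine (spectralGap_logEval hα hβ N n (Q n) (hQ n) fun P hP => ?_).trans ?_
    · rw [← hvQ n P (degreeLT_mono' hn hP), horth P hP]
    -- Since D*D Q has degree < n, ⟨Dv, DQ⟩ = ⟨v, D*DQ⟩ = ⟨Q, D*DQ⟩ = ⟨DQ, DQ⟩, so ‖DQ‖ ≤ ‖Dv‖.
    · have h1 : inner2 (α + 1) β (fun t => t * v' t) (logEval (derivative (Q n))) =
          inner2 (α + 1) β (logEval (derivative (Q n))) (logEval (derivative (Q n))) := by
        rw [inner2_mul_logEval hα hβ h hv hv', inner2_derivative_logEval hα hβ]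
        exact hvQ n _ (adjPoly_derivative_mem (hQ n))
      have h2 := inner2_self_nonneg (α + 1) β ((fun t => t * v' t) - logEval (derivative (Q n)))
      rw [inner2_sub_self hv' (hm' _), h1] at h2
      linarith
  have hlim2 : Tendsto (fun n => inner2 α β (logEval (Q n)) (logEval (Q n))) atTop
      (𝓝 (inner2 α β v v)) := by
    have h3 := hlim.const_sub (inner2 α β v v)
    rw [sub_zero] at h3
    refine h3.congr fun n => ?_
    rw [inner2_sub_self hv (hm _), hvQ n _ (hQ n)]
    ring
  refine le_of_tendsto (hlim2.const_mul (N * (β + 1))) ?_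
  filter_upwards [eventually_ge_atTop N] with n hn using hbound n hn

end SpectralGap

/-! ### Iterated pseudo-derivatives. -/

lemma isWeakDeriv_weakDeriv {u : ℝ → ℝ} (h : HasWeakDeriv u) : IsWeakDeriv u (weakDeriv u) := by
  rw [weakDeriv, dif_pos h]
  exact Classical.choose_spec h

lemma memL2_iterate {m : ℕ} {α β : ℝ} {v : ℝ → ℝ} (hv : v ∈ spaceA m α β) {j : ℕ} (hj : j ≤ m) :
    MemL2 (α + j) β (pseudoDeriv^[j] v) := by
  rcases j with _ | j
  · simpa using hv.1
  · exact (hv.2 j hj).2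

/-- `weakDeriv` is a chosen representative, so only almost everywhere equality survives; assuming no
more about v lets the statement be iterated. -/
lemma pseudoDeriv_sub_logEval {u v : ℝ → ℝ} {P : ℝ[X]} (hu : HasWeakDeriv u)
    (h : v =ᵐ[volume.restrict (Ioo (0 : ℝ) 1)] u - logEval P) :
    HasWeakDeriv v ∧ pseudoDeriv v =ᵐ[volume.restrict (Ioo (0 : ℝ) 1)]
      pseudoDeriv u - logEval (derivative P) := by
  have hw := ((isWeakDeriv_weakDeriv hu).sub (isWeakDeriv_logEval P)).congr h.symm (ae_eq_refl _)
  refine ⟨⟨_, hw⟩, ?_⟩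
  filter_upwards [(isWeakDeriv_weakDeriv ⟨_, hw⟩).unique hw, ae_restrict_mem measurableSet_Ioo]
    with t ht hmem
  have := hmem.1.ne'
  simp only [pseudoDeriv, ht, Pi.sub_apply]
  field_simp

lemma iterate_pseudoDeriv_sub_logEval {m : ℕ} {α β : ℝ} {u : ℝ → ℝ} (hu : u ∈ spaceA m α β)
    (P : ℝ[X]) : ∀ j ≤ m, pseudoDeriv^[j] (u - logEval P) =ᵐ[volume.restrict (Ioo (0 : ℝ) 1)]
      pseudoDeriv^[j] u - logEval (derivative^[j] P) := by
  intro j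
  induction j with
  | zero => exact fun _ => ae_eq_refl _
  | succ j ih =>
    intro hj
    rw [Function.iterate_succ_apply', Function.iterate_succ_apply', Function.iterate_succ_apply']
    exact (pseudoDeriv_sub_logEval (hu.2 j hj).1 (ih (Nat.le_of_succ_le hj))).2

lemma neg_one_lt_add_natCast {α : ℝ} (hα : -1 < α) (j : ℕ) : -1 < α + (j : ℝ) := by
  have : (0 : ℝ) ≤ j := j.cast_nonneg
  linarith

lemma sub_logEval_mem_spaceA {m : ℕ} {α β : ℝ} (hα : -1 < α) (hβ : -1 < β) {u : ℝ → ℝ}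
    (hu : u ∈ spaceA m α β) (P : ℝ[X]) : u - logEval P ∈ spaceA m α β := by
  refine ⟨hu.1.sub (memL2_logEval hα hβ P), fun j hj => ⟨?_, ?_⟩⟩
  · exact (pseudoDeriv_sub_logEval (hu.2 j hj).1
      (iterate_pseudoDeriv_sub_logEval hu P j hj.le)).1
  · have h := ae_chiMeasure (α := α + ((j + 1 : ℕ) : ℝ)) (β := β) |>.2
      (iterate_pseudoDeriv_sub_logEval hu P (j + 1) hj)
    exact (memLp_congr_ae h).2 ((hu.2 j hj).2.sub
      (memL2_logEval (neg_one_lt_add_natCast hα _) hβ _))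

lemma add_natCast_succ (α : ℝ) (j : ℕ) : α + ((j + 1 : ℕ) : ℝ) = α + j + 1 := by
  push_cast; ring

/-- Pseudo-derivatives of a function orthogonal to polynomials in `log t` are again orthogonal to
such polynomials, of one degree less each time. -/
lemma inner2_iterate_logEval_eq_zero {m n : ℕ} {α β : ℝ} (hα : -1 < α) (hβ : -1 < β) {v : ℝ → ℝ}
    (hv : v ∈ spaceA m α β) (h : ∀ P ∈ degreeLT ℝ n, inner2 α β v (logEval P) = 0) :
    ∀ j ≤ m, ∀ P ∈ degreeLT ℝ (n - j),
      inner2 (α + j) β (pseudoDeriv^[j] v) (logEval P) = 0 := by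
  intro j
  induction j with
  | zero => simpa using h
  | succ j ih =>
    intro hj P hP
    obtain ⟨hw, hL⟩ := hv.2 j hj
    rw [Function.iterate_succ_apply', add_natCast_succ] at hL ⊢
    refine (inner2_mul_logEval (neg_one_lt_add_natCast hα j) hβ (isWeakDeriv_weakDeriv hw)
      (memL2_iterate hv (Nat.le_of_succ_le hj)) hL P).trans
      (ih (Nat.le_of_succ_le hj) _ (adjPoly_mem_degreeLT ?_))
    rwa [Nat.sub_sub]

/-- Each step applies the gap (n-j)(β+1) to the j-th pseudo-derivative, which is orthogonal to
degrees < n - j. The factors telescope into factorials, cross-multiplied to avoid division. -/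
lemma inner2_iterate_le {m n k : ℕ} {α β : ℝ} (hα : -1 < α) (hβ : -1 < β) {v : ℝ → ℝ}
    (hv : v ∈ spaceA m α β) (h : ∀ P ∈ degreeLT ℝ n, inner2 α β v (logEval P) = 0) {j : ℕ}
    (hkj : k ≤ j) : j ≤ min m n →
      ((n - k)! : ℝ) * (β + 1) ^ j *
        inner2 (α + k) β (pseudoDeriv^[k] v) (pseudoDeriv^[k] v) ≤
      ((n - j)! : ℝ) * (β + 1) ^ k *
        inner2 (α + j) β (pseudoDeriv^[j] v) (pseudoDeriv^[j] v) := by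
  have hb : 0 < β + 1 := by linarith
  induction j, hkj using Nat.le_induction with
  | base => exact fun _ => le_rfl
  | succ j hkj ih =>
    intro hj
    have hjm : j < m := (le_min_iff.1 hj).1
    have hjn : j < n := (le_min_iff.1 hj).2
    obtain ⟨hw, hL⟩ := hv.2 j hjm
    rw [Function.iterate_succ_apply', add_natCast_succ] at hL ⊢
    have hgap := spectralGap (neg_one_lt_add_natCast hα j) hβ (n - j) (isWeakDeriv_weakDeriv hw)
      (memL2_iterate hv hjm.le) hL (inner2_iterate_logEval_eq_zero hα hβ hv h j hjm.le)
    have hfac : ((n - j)! : ℝ) = ((n - j : ℕ) : ℝ) * ((n - (j + 1))! : ℝ) := by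
      rw [← Nat.cast_mul, ← Nat.mul_factorial_pred (by omega : n - j ≠ 0), Nat.sub_sub]
    calc ((n - k)! : ℝ) * (β + 1) ^ (j + 1) *
          inner2 (α + k) β (pseudoDeriv^[k] v) (pseudoDeriv^[k] v)
        = (β + 1) * (((n - k)! : ℝ) * (β + 1) ^ j *
          inner2 (α + k) β (pseudoDeriv^[k] v) (pseudoDeriv^[k] v)) := by ring
      _ ≤ (β + 1) * (((n - j)! : ℝ) * (β + 1) ^ k *
          inner2 (α + j) β (pseudoDeriv^[j] v) (pseudoDeriv^[j] v)) :=
        mul_le_mul_of_nonneg_left (ih (Nat.le_of_succ_le hj)) hb.le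
      _ = ((n - (j + 1))! : ℝ) * (β + 1) ^ k * (((n - j : ℕ) : ℝ) * (β + 1) *
          inner2 (α + j) β (pseudoDeriv^[j] v) (pseudoDeriv^[j] v)) := by rw [hfac]; ring
      _ ≤ _ := mul_le_mul_of_nonneg_left hgap (by positivity)

lemma iterate_derivative_mem_degreeLT {P : ℝ[X]} {n : ℕ} (hP : P ∈ degreeLT ℝ n) (j : ℕ) :
    derivative^[j] P ∈ degreeLT ℝ (n - j) := by
  induction j with
  | zero => simpa using hP
  | succ j ih =>
    rw [Function.iterate_succ_apply', ← Nat.sub_sub]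
    exact derivative_mem_degreeLT ih

/-- The j-th derivative of P has degree < n - j, exactly the range to which D^j(u - P(log t)) is
orthogonal; Pythagoras applies. -/
lemma inner2_iterate_sub_le {m n : ℕ} {α β : ℝ} (hα : -1 < α) (hβ : -1 < β) {u : ℝ → ℝ}
    (hu : u ∈ spaceA m α β) {P : ℝ[X]} (hP : P ∈ degreeLT ℝ n)
    (h : ∀ Q ∈ degreeLT ℝ n, inner2 α β (u - logEval P) (logEval Q) = 0) {j : ℕ} (hj : j ≤ m) :
    inner2 (α + j) β (pseudoDeriv^[j] (u - logEval P)) (pseudoDeriv^[j] (u - logEval P)) ≤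
      inner2 (α + j) β (pseudoDeriv^[j] u) (pseudoDeriv^[j] u) := by
  have hα' := neg_one_lt_add_natCast hα j
  have hv := sub_logEval_mem_spaceA hα hβ hu P
  have hae := ae_chiMeasure (α := α + j) (β := β) |>.2 (iterate_pseudoDeriv_sub_logEval hu P j hj)
  have ho := inner2_iterate_logEval_eq_zero hα hβ hv h j hj _
    (iterate_derivative_mem_degreeLT hP j)
  have hL := memL2_logEval hα' hβ (derivative^[j] P)
  have hU := memL2_iterate hu hj
  rw [inner2_congr hae (ae_eq_refl _), inner2_sub_left hU hL hL] at ho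
  rw [inner2_congr hae hae, inner2_sub_self hU hL]
  have := inner2_self_nonneg (α + j) β (logEval (derivative^[j] P))
  linarith

/-! ### The projection estimate and its constant. -/

lemma isLogProjection_logEval_iff {N : ℕ} {α β : ℝ} {u p : ℝ → ℝ} :
    IsLogProjection α β N u p ↔ ∃ P ∈ degreeLT ℝ (N + 1), logEval P = p ∧
      ∀ Q ∈ degreeLT ℝ (N + 1), inner2 α β (u - logEval P) (logEval Q) = 0 := by
  constructor
  · rintro ⟨hp, h⟩
    obtain ⟨P, hP, rfl⟩ := mem_logPoly.1 hp
    exact ⟨P, hP, rfl, fun Q hQ => h _ (mem_logPoly.2 ⟨Q, hQ, rfl⟩)⟩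
  · rintro ⟨P, hP, rfl, h⟩
    refine ⟨mem_logPoly.2 ⟨P, hP, rfl⟩, fun v hv => ?_⟩
    obtain ⟨Q, hQ, rfl⟩ := mem_logPoly.1 hv
    exact h Q hQ

lemma existsUnique_isLogProjection (N : ℕ) {α β : ℝ} (hα : -1 < α) (hβ : -1 < β) {u : ℝ → ℝ}
    (hu : MemL2 α β u) : ∃! p : ℝ → ℝ, IsLogProjection α β N u p := by
  obtain ⟨Q, hQ, hQo, -⟩ := exists_projections hα hβ hu
  refine ⟨logEval (Q (N + 1)),
    isLogProjection_logEval_iff.2 ⟨_, hQ (N + 1), rfl, hQo (N + 1)⟩, fun p hp => ?_⟩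
  obtain ⟨P, hP, rfl, hPo⟩ := isLogProjection_logEval_iff.1 hp
  have hm := fun R => memL2_logEval hα hβ R
  -- Uniqueness holds for functions, not just almost everywhere, because it is proved for the
  -- polynomials that define them.
  congr 1
  refine sub_eq_zero.1 (inner2_logEval_self_eq_zero hα hβ ?_)
  have hR : P - Q (N + 1) ∈ degreeLT ℝ (N + 1) := Submodule.sub_mem _ hP (hQ (N + 1))
  have h1 := hPo _ hR
  have h2 := hQo (N + 1) _ hR
  rw [inner2_sub_left hu (hm _) (hm _)] at h1 h2
  nth_rewrite 1 [map_sub]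
  rw [inner2_sub_left (hm _) (hm _) (hm _)]
  linarith

lemma norm2_iterate_sub_le {m N k : ℕ} {α β : ℝ} (hα : -1 < α) (hβ : -1 < β)
    (hk : k ≤ min m (N + 1)) {u p : ℝ → ℝ} (hu : u ∈ spaceA m α β)
    (hp : IsLogProjection α β N u p) :
    u - p ∈ spaceA m α β ∧
      norm2 (α + (k : ℝ)) β (pseudoDeriv^[k] (u - p)) ≤
        Real.sqrt ((β + 1) ^ ((k : ℤ) - ((min m (N + 1) : ℕ) : ℤ)) *
            (((N + 1 - min m (N + 1))! : ℝ) / ((N + 1 - k)! : ℝ))) *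
          norm2 (α + ((min m (N + 1) : ℕ) : ℝ)) β (pseudoDeriv^[min m (N + 1)] u) := by
  obtain ⟨P, hP, rfl, hPo⟩ := isLogProjection_logEval_iff.1 hp
  have hv := sub_logEval_mem_spaceA hα hβ hu P
  refine ⟨hv, ?_⟩
  have hb : 0 < β + 1 := by linarith
  have h1 := inner2_iterate_le hα hβ hv hPo hk le_rfl
  have h2 := inner2_iterate_sub_le hα hβ hu hP hPo (min_le_left m (N + 1))
  have hkm : k ≤ m := hk.trans (min_le_left _ _)
  set M := min m (N + 1) with hM
  have hMm : M ≤ m := min_le_left _ _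
  rw [← norm2_sq (memL2_iterate hv hkm), ← norm2_sq (memL2_iterate hv hMm)] at h1
  rw [← norm2_sq (memL2_iterate hv hMm), ← norm2_sq (memL2_iterate hu hMm)] at h2
  refine le_of_sq_le_sq ?_ (mul_nonneg (Real.sqrt_nonneg _) (norm2_nonneg _ _ _))
  rw [mul_pow, Real.sq_sqrt (by positivity), zpow_sub₀ hb.ne', zpow_natCast, zpow_natCast,
    div_mul_div_comm, div_mul_eq_mul_div, le_div_iff₀ (by positivity)]
  calc norm2 (α + k) β (pseudoDeriv^[k] (u - logEval P)) ^ 2 * ((β + 1) ^ M * ((N + 1 - k)! : ℝ))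
      = ((N + 1 - k)! : ℝ) * (β + 1) ^ M *
        norm2 (α + k) β (pseudoDeriv^[k] (u - logEval P)) ^ 2 := by ring
    _ ≤ _ := h1
    _ ≤ ((N + 1 - M)! : ℝ) * (β + 1) ^ k * norm2 (α + M) β (pseudoDeriv^[M] u) ^ 2 :=
      mul_le_mul_of_nonneg_left h2 (by positivity)
    _ = _ := by ring

/-- With N = m + d, the constant comes from m + d ≤ (m+1)(d+2) and (d+1)! (d+2)^m ≤ (d+1+m)!. -/
lemma sqrt_factorial_div_le {m N : ℕ} (h : m < N + 1) :
    Real.sqrt (((N + 1 - m)! : ℝ) / ((N + 1)! : ℝ)) ≤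
      Real.sqrt ((m + 1) ^ m) * (N : ℝ) ^ (-(m : ℝ) / 2) := by
  have hN : (0 : ℝ) ≤ N := N.cast_nonneg
  refine Real.sqrt_le_iff.2 ⟨by positivity, ?_⟩
  have e : ((N : ℝ) ^ (-(m : ℝ) / 2)) ^ 2 = ((N : ℝ) ^ m)⁻¹ := by
    rw [← Real.rpow_natCast, ← Real.rpow_mul hN, ← Real.rpow_natCast (N : ℝ) m,
      ← Real.rpow_neg hN]
    norm_num
  -- N = 0 forces m = 0, and then 0^0 = 1.
  have hpos : (0 : ℝ) < (N : ℝ) ^ m := by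
    rcases Nat.eq_zero_or_pos N with rfl | h0
    · obtain rfl : m = 0 := by omega
      simp
    · positivity
  rw [mul_pow, Real.sq_sqrt (by positivity), e, ← div_eq_mul_inv, div_le_div_iff₀ (by positivity)
    hpos]
  have key : (N + 1 - m)! * N ^ m ≤ (m + 1) ^ m * (N + 1)! := by
    obtain ⟨d, rfl⟩ : ∃ d, N = m + d := ⟨N - m, by omega⟩
    have h1 : m + d + 1 - m = d + 1 := by omega
    have h2 : (d + 1)! * (d + 2) ^ m ≤ (d + 1 + m)! := Nat.factorial_mul_pow_le_factorial
    rw [h1]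
    calc (d + 1)! * (m + d) ^ m ≤ (d + 1)! * ((m + 1) * (d + 2)) ^ m := by
          gcongr
          nlinarith
      _ = (m + 1) ^ m * ((d + 1)! * (d + 2) ^ m) := by rw [mul_pow]; ring
      _ ≤ (m + 1) ^ m * (d + 1 + m)! := by gcongr
      _ = (m + 1) ^ m * (m + d + 1)! := by rw [show d + 1 + m = m + d + 1 by ring]
  exact_mod_cast key

end LOF

theorem mainTheorem1 :
    -- the orthogonal projection exists and is unique
    (∀ (N : ℕ) (α β : ℝ), -1 < α → -1 < β → ∀ u : ℝ → ℝ, LOF.MemL2 α β u →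
      ∃! p : ℝ → ℝ, LOF.IsLogProjection α β N u p) ∧
    -- the projection estimate
    (∀ (m N k : ℕ) (α β : ℝ), -1 < α → -1 < β → k ≤ min m (N + 1) →
      ∀ u ∈ LOF.spaceA m α β, ∀ p : ℝ → ℝ, LOF.IsLogProjection α β N u p →
        u - p ∈ LOF.spaceA m α β ∧
        LOF.norm2 (α + (k : ℝ)) β (LOF.pseudoDeriv^[k] (u - p)) ≤
          Real.sqrt ((β + 1) ^ ((k : ℤ) - ((min m (N + 1) : ℕ) : ℤ)) *
              (((N + 1 - min m (N + 1))! : ℝ) / ((N + 1 - k)! : ℝ))) *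
            LOF.norm2 (α + ((min m (N + 1) : ℕ) : ℝ)) β (LOF.pseudoDeriv^[min m (N + 1)] u)) ∧
    -- the special case of vanishing parameters
    (∀ m : ℕ, ∃ c : ℝ, 0 < c ∧ ∀ N : ℕ, m < N + 1 →
      ∀ u ∈ LOF.spaceA m 0 0, ∀ p : ℝ → ℝ, LOF.IsLogProjection 0 0 N u p →
        LOF.norm2 0 0 (u - p) ≤
          c * (N : ℝ) ^ (-(m : ℝ) / 2) * LOF.norm2 (m : ℝ) 0 (LOF.pseudoDeriv^[m] u)) := by

  refine ⟨fun N α β hα hβ u hu => LOF.existsUnique_isLogProjection N hα hβ hu,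
    fun m N k α β hα hβ hk u hu p hp => LOF.norm2_iterate_sub_le hα hβ hk hu hp,
    fun m => ⟨Real.sqrt (((m : ℝ) + 1) ^ m), Real.sqrt_pos.2 (by positivity),
      fun N hN u hu p hp => ?_⟩⟩
  have h := (LOF.norm2_iterate_sub_le (k := 0) (by norm_num) (by norm_num) (Nat.zero_le _)
    hu hp).2
  rw [min_eq_left hN.le] at h
  simp only [Nat.cast_zero, add_zero, zero_add, one_zpow, one_mul, Function.iterate_zero, id_eq,
    Nat.sub_zero] at h
  exact h.trans (mul_le_mul_of_nonneg_right (LOF.sqrt_factorial_div_le hN)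
    (LOF.norm2_nonneg _ _ _))
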